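/- Let $n\ge 2$ be an integer. For $\mathbf{x}=(x_1,\dots,x_n)\in\mathbb{R}^n$ and $\mathbf{q}=(q_1,\dots,q_{n+1})\in\mathbb{Z}^{n+1}$ put $L_{\mathbf{x}}(\mathbf{q})=q_1x_1+\cdots+q_nx_n+q_{n+1}$ and $\hat{\mathbf{q}}=(q_1,\dots,q_n)$, and let $\|\cdot\|$ be the maximum norm. Call $\mathbf{x}$ totally irrational if $L_{\mathbf{x}}(\mathbf{q})\ne 0$ for every nonzero $\mathbf{q}\in\mathbb{Z}^{n+1}$. A vector $\mathbf{q}\in\mathbb{Z}^{n+1}$ with $\hat{\mathbf{q}}\neq \mathbf{0}$ is a best approximation for $\mathbf{x}$ if $$|L_{\mathbf{x}}(\mathbf{q})|=\min\{|L_{\mathbf{x}}(\mathbf{b})| : \mathbf{b}\in\mathbb{Z}^{n+1},\ 0<\|\hat{\mathbf{b}}\|\le\|\hat{\mathbf{q}}\|\}.$$ For totally irrational $\mathbf{x}$, the best approximations, listed up to sign by increasing norm $\|\hat{\mathbf{q}}\|$, form an infinite sequence $(\mathbf{q}_j)_{j\ge 1}$, unique up to signs. Let $R(\mathbf{x})$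 be the minimum integer $R$ such that some tail $(\mathbf{q}_j)_{j\ge j_0}$ lies in an $R$-dimensional sublattice (a subgroup of rank $R$) of $\mathbb{Z}^{n+1}$. Then for every integer $r$ with $3\le r\le n+1$, the set $$\{\mathbf{x}\in\mathbb{R}^n : \mathbf{x}\text{ is totally irrational and } R(\mathbf{x})=r\}$$ has positive Hausdorff dimension (in particular, it is nonempty). -/

import Mathlib

namespace BestApprox

/-- The linear form `q · (x, 1) = q₁ x₁ + ⋯ + qₙ xₙ + qₙ₊₁`. -/
def linForm {n : ℕ} (x : Fin n → ℝ) (q : Fin (n + 1) → ℤ) : ℝ :=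
  (∑ i : Fin n, (q i.castSucc : ℝ) * x i) + (q (Fin.last n) : ℝ)

/-- The restriction of an integer vector to its first `n` coordinates. The type `Fin n → ℤ`
carries the maximum norm. -/
def hat {n : ℕ} (q : Fin (n + 1) → ℤ) : Fin n → ℤ := fun i => q i.castSucc

/-- `x` is totally irrational: the linear form vanishes at no non-zero integer vector. -/
def TotallyIrrational {n : ℕ} (x : Fin n → ℝ) : Prop :=
  ∀ q : Fin (n + 1) → ℤ, q ≠ 0 → linForm x q ≠ 0

/-- `q` is a best approximation for `x`: its restriction is non-zero, and `|q · (x, 1)|` is the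
minimum of `|b · (x, 1)|` over all integer vectors `b` with `0 < ‖hat b‖ ≤ ‖hat q‖`. -/
def IsBestApprox {n : ℕ} (x : Fin n → ℝ) (q : Fin (n + 1) → ℤ) : Prop :=
  0 < ‖hat q‖ ∧
    ∀ b : Fin (n + 1) → ℤ, 0 < ‖hat b‖ → ‖hat b‖ ≤ ‖hat q‖ → |linForm x q| ≤ |linForm x b|

/-- `q` is a sequence of best approximations associated to `x`: it lists all best approximations
of `x`, up to sign, in the order of increasing norms. -/
def IsBestApproxSeq {n : ℕ} (x : Fin n → ℝ) (q : ℕ → Fin (n + 1) → ℤ) : Prop :=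
  (∀ j, IsBestApprox x (q j)) ∧
    StrictMono (fun j => ‖hat (q j)‖) ∧
    ∀ b : Fin (n + 1) → ℤ, IsBestApprox x b → ∃ j, b = q j ∨ b = -q j

/-- The minimum `R` such that some tail of the sequence of best approximations of `x` lies in an
`R`-dimensional sublattice of `ℤⁿ⁺¹`. (The sequence is unique up to signs when `x` is totally
irrational, and a sublattice is closed under negation.) -/
noncomputable def R {n : ℕ} (x : Fin n → ℝ) : ℕ :=
  sInf {r : ℕ | ∃ q : ℕ → Fin (n + 1) → ℤ, IsBestApproxSeq x q ∧
    ∃ L : Submodule ℤ (Fin (n + 1) → ℤ), Module.finrank ℤ L = r ∧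
      ∃ j₀ : ℕ, ∀ j, j₀ ≤ j → q j ∈ L}

end BestApprox

/-! For `r = n + 1`, almost every point works. By Dirichlet, a best approximation satisfies
`|linForm x q| ≤ ‖hat q‖⁻ⁿ`, which confines `x` to a slab of volume `O(‖q‖⁻ⁿ⁻¹)`. The sum of these
volumes over a sublattice of rank at most `n` converges, so by Borel–Cantelli almost every `x` has
only finitely many best approximations there. There are only countably many sublattices (`ae_R_eq`).

For `r = m + 1 ≤ n`, so `m ≥ 2`, the first `m` coordinates are fixed lacunary sums of `1 / D j`,
where `D (j + 1) = D j ^ (n + 4)` and the index `j` goes to the coordinate `j % m`. Truncation at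
`k` gives integer vectors `approx` of height `D k` with form at most `2 D k / D (k + m)`. The other
coordinates are free. For almost every choice of them, the form is at least `c ‖hat q‖ ^ (-(n + 2))`
at every `q` involving a free coordinate (`ae_exists_le_linForm`). Since `D (k + m) ≥ D (k + 2)`,
for large `k` the vector `approx` at `k` beats all such `q` of height up to `D (k + 1)`. These
ranges cover all large heights, so a tail of the best approximations lies in the coordinate lattice
of rank `m + 1`. Inside that lattice the `approx` vectors are themselves best
(`abs_linForm_approx_le_abs_linForm`), and any `m + 1` consecutive ones are independent, so no
smaller rank suffices.

In both cases the free coordinates fill a set of positive Lebesgue measure, which bounds the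
dimension from below (`dimH_pos_of_ae_glue_mem`). -/

open MeasureTheory

namespace BestApprox

/-! ### Dirichlet's theorem and the sequence of best approximations. -/

variable {n : ℕ}

/-- The maximum norm of an integer vector, as a natural number. -/
def height {ι : Type*} [Fintype ι] (v : ι → ℤ) : ℕ := Finset.univ.sup fun i => (v i).natAbs

lemma norm_eq_height {ι : Type*} [Fintype ι] (v : ι → ℤ) : ‖v‖ = height v := by
  apply le_antisymm
  · rw [pi_norm_le_iff_of_nonneg (Nat.cast_nonneg _)]
    intro i
    rw [Int.norm_eq_abs, ← Int.cast_abs, Int.abs_eq_natAbs, Int.cast_natCast, Nat.cast_le]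
    exact Finset.le_sup (f := fun i => (v i).natAbs) (Finset.mem_univ i)
  · suffices height v ≤ ⌊‖v‖⌋₊ from (Nat.le_floor_iff (norm_nonneg v)).1 this
    refine Finset.sup_le fun i _ => Nat.le_floor ?_
    rw [Nat.cast_natAbs, Int.cast_abs, ← Int.norm_eq_abs]
    exact norm_le_pi_norm v i

lemma one_le_norm_of_pos {ι : Type*} [Fintype ι] {v : ι → ℤ} (h : 0 < ‖v‖) : 1 ≤ ‖v‖ := by
  rw [norm_eq_height] at *
  exact_mod_cast h

lemma abs_le_norm {ι : Type*} [Fintype ι] (v : ι → ℤ) (i : ι) : |(v i : ℝ)| ≤ ‖v‖ :=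
  norm_le_pi_norm v i

lemma linForm_sub (x : Fin n → ℝ) (a b : Fin (n + 1) → ℤ) :
    linForm x (a - b) = linForm x a - linForm x b := by
  simp only [linForm, Pi.sub_apply, Int.cast_sub, sub_mul, Finset.sum_sub_distrib]
  ring

lemma linForm_add (x : Fin n → ℝ) (a b : Fin (n + 1) → ℤ) :
    linForm x (a + b) = linForm x a + linForm x b := by
  simp only [linForm, Pi.add_apply, Int.cast_add, add_mul, Finset.sum_add_distrib]
  ring

lemma linForm_smul (x : Fin n → ℝ) (c : ℤ) (a : Fin (n + 1) → ℤ) :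
    linForm x (c • a) = c * linForm x a := by
  simp only [linForm, Pi.smul_apply, smul_eq_mul, Int.cast_mul, mul_add, Finset.mul_sum, mul_assoc]

/-- The last coordinate is the value of the form minus the contribution of the others. Hence bounded
height and bounded form leave finitely many vectors. -/
lemma norm_le_of_hat (x : Fin n → ℝ) (b : Fin (n + 1) → ℤ) :
    ‖b‖ ≤ (∑ i, |x i| + 1) * ‖hat b‖ + |linForm x b| := by
  have h0 : ∑ i : Fin n, |(b i.castSucc : ℝ) * x i| ≤ (∑ i, |x i|) * ‖hat b‖ := by
    rw [Finset.sum_mul]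
    refine Finset.sum_le_sum fun i _ => ?_
    rw [abs_mul, mul_comm]
    exact mul_le_mul_of_nonneg_left (abs_le_norm (hat b) i) (abs_nonneg _)
  have hs : 0 ≤ ∑ i, |x i| := Finset.sum_nonneg fun i _ => abs_nonneg _
  have hh := norm_nonneg (hat b)
  rw [pi_norm_le_iff_of_nonneg (by positivity)]
  intro i
  rw [Int.norm_eq_abs]
  refine Fin.lastCases ?_ (fun i => ?_) i
  · have h1 : (b (Fin.last n) : ℝ) = linForm x b - ∑ i : Fin n, (b i.castSucc : ℝ) * x i := by
      simp [linForm]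
    rw [h1]
    have := abs_sub (linForm x b) (∑ i : Fin n, (b i.castSucc : ℝ) * x i)
    have := Finset.abs_sum_le_sum_abs (fun i : Fin n => (b i.castSucc : ℝ) * x i) Finset.univ
    linarith
  · have : |(b i.castSucc : ℝ)| ≤ ‖hat b‖ := abs_le_norm (hat b) i
    have := abs_nonneg (linForm x b)
    nlinarith

lemma finite_norm_le {ι : Type*} [Fintype ι] (M : ℝ) : {b : ι → ℤ | ‖b‖ ≤ M}.Finite := by
  have := (isCompact_closedBall (0 : ι → ℤ) M).finite_of_discrete
  refine this.subset fun b hb => ?_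
  simpa using hb

/-- Dirichlet's theorem for one linear form. -/
lemma exists_linForm_le (hn : 1 ≤ n) (x : Fin n → ℝ) (N : ℕ) (hN : 1 ≤ N) :
    ∃ b : Fin (n + 1) → ℤ, 0 < ‖hat b‖ ∧ ‖hat b‖ ≤ N ∧ |linForm x b| ≤ 1 / (N : ℝ) ^ n := by
  have hN0 : (0 : ℝ) < N := by exact_mod_cast hN
  have hNn : (0 : ℝ) < (N : ℝ) ^ n := by positivity
  let s : (Fin n → Fin (N + 1)) → ℝ := fun v => ∑ i, ((v i : ℕ) : ℝ) * x i
  -- Pigeonhole: `(N + 1) ^ n` fractional parts fall into `N ^ n` intervals of length `1 / N ^ n`.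
  let f : (Fin n → Fin (N + 1)) → ℕ := fun v => ⌊Int.fract (s v) * (N : ℝ) ^ n⌋₊
  have hf : ∀ v ∈ (Finset.univ : Finset (Fin n → Fin (N + 1))), f v ∈ Finset.range (N ^ n) := by
    intro v _
    rw [Finset.mem_range, Nat.floor_lt (mul_nonneg (Int.fract_nonneg _) hNn.le)]
    push_cast
    nlinarith [Int.fract_lt_one (s v)]
  have hcard : (Finset.range (N ^ n)).card < (Finset.univ : Finset (Fin n → Fin (N + 1))).card := by
    simp only [Finset.card_range, Finset.card_univ, Fintype.card_fun, Fintype.card_fin]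
    exact Nat.pow_lt_pow_left (Nat.lt_succ_self N) (by omega)
  obtain ⟨v, -, w, -, hvw, he⟩ := Finset.exists_ne_map_eq_of_card_lt_of_maps_to hcard hf
  let b : Fin (n + 1) → ℤ := Fin.snoc (α := fun _ => ℤ)
    (fun i => ((v i : ℕ) : ℤ) - ((w i : ℕ) : ℤ)) (⌊s w⌋ - ⌊s v⌋)
  have hb : hat b = fun i => ((v i : ℕ) : ℤ) - ((w i : ℕ) : ℤ) := by
    ext i; simp [hat, b]
  refine ⟨b, ?_, ?_, ?_⟩
  · rw [norm_pos_iff, hb]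
    intro h
    apply hvw
    ext i
    have := congrFun h i
    simp only [Pi.zero_apply] at this
    omega
  · rw [pi_norm_le_iff_of_nonneg hN0.le, hb]
    intro i
    rw [Int.norm_eq_abs, ← Int.cast_abs]
    have h1 := (v i).2
    have h2 := (w i).2
    have : |((v i : ℕ) : ℤ) - ((w i : ℕ) : ℤ)| ≤ N := by
      rw [abs_le]; constructor <;> omega
    exact_mod_cast this
  · have hL : linForm x b = Int.fract (s v) - Int.fract (s w) := by
      simp only [linForm, b, Fin.snoc_castSucc, Fin.snoc_last, Int.fract, s]
      push_cast
      simp only [sub_mul, Finset.sum_sub_distrib]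
      ring
    have key : |Int.fract (s v) * (N : ℝ) ^ n - Int.fract (s w) * (N : ℝ) ^ n| < 1 := by
      have a1 := Nat.floor_le (mul_nonneg (Int.fract_nonneg (s v)) hNn.le)
      have a2 := Nat.floor_le (mul_nonneg (Int.fract_nonneg (s w)) hNn.le)
      have a3 := Nat.lt_floor_add_one (Int.fract (s v) * (N : ℝ) ^ n)
      have a4 := Nat.lt_floor_add_one (Int.fract (s w) * (N : ℝ) ^ n)
      have he' : ((⌊Int.fract (s v) * (N : ℝ) ^ n⌋₊ : ℕ) : ℝ) = ⌊Int.fract (s w) * (N : ℝ) ^ n⌋₊ := by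
        exact congrArg Nat.cast he
      rw [abs_lt]
      constructor <;> linarith
    rw [← sub_mul, abs_mul, abs_of_pos hNn] at key
    rw [hL, le_div_iff₀ hNn]
    exact key.le

lemma exists_isBestApprox_le (hn : 1 ≤ n) (x : Fin n → ℝ) (N : ℕ) (hN : 1 ≤ N) :
    ∃ q, IsBestApprox x q ∧ ‖hat q‖ ≤ N ∧
      ∀ b : Fin (n + 1) → ℤ, 0 < ‖hat b‖ → ‖hat b‖ ≤ N → |linForm x q| ≤ |linForm x b| := by
  obtain ⟨b₀, h1, h2, -⟩ := exists_linForm_le hn x N hN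
  -- The cap by the form at `b₀` makes the set of candidates finite without losing the minimum.
  let T : Set (Fin (n + 1) → ℤ) :=
    {b | 0 < ‖hat b‖ ∧ ‖hat b‖ ≤ N ∧ |linForm x b| ≤ |linForm x b₀|}
  have hT : T.Finite := by
    refine (finite_norm_le ((∑ i, |x i| + 1) * N + |linForm x b₀|)).subset ?_
    rintro b ⟨-, hb, hb'⟩
    refine (norm_le_of_hat x b).trans ?_
    have hs : 0 ≤ ∑ i, |x i| := Finset.sum_nonneg fun i _ => abs_nonneg _
    gcongr
  obtain ⟨q, hq, hmin⟩ := Set.exists_min_image T (fun b => |linForm x b|) hT ⟨b₀, h1, h2, le_rfl⟩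
  have hall : ∀ b : Fin (n + 1) → ℤ, 0 < ‖hat b‖ → ‖hat b‖ ≤ N → |linForm x q| ≤ |linForm x b| := by
    intro b hb hb'
    by_cases h : |linForm x b| ≤ |linForm x b₀|
    · exact hmin b ⟨hb, hb', h⟩
    · exact hq.2.2.trans (le_of_not_ge h)
  exact ⟨q, ⟨hq.1, fun b hb hb' => hall b hb (hb'.trans hq.2.1)⟩, hq.2.1, hall⟩

lemma IsBestApprox.abs_linForm_le (hn : 1 ≤ n) {x : Fin n → ℝ} {q : Fin (n + 1) → ℤ}
    (hq : IsBestApprox x q) : |linForm x q| ≤ 1 / ‖hat q‖ ^ n := by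
  have h := hq.1
  rw [norm_eq_height] at h ⊢
  obtain ⟨b, h1, h2, h3⟩ := exists_linForm_le hn x (height (hat q)) (by exact_mod_cast h)
  refine (hq.2 b h1 ?_).trans h3
  rwa [norm_eq_height (hat q)]

lemma TotallyIrrational.eq_or_eq_neg {x : Fin n → ℝ} (hx : TotallyIrrational x)
    {a b : Fin (n + 1) → ℤ} (h : |linForm x a| = |linForm x b|) : a = b ∨ a = -b := by
  rcases abs_eq_abs.1 h with h | h
  · left
    by_contra hab
    exact hx (a - b) (sub_ne_zero.2 hab) (by rw [linForm_sub, h, sub_self])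
  · right
    by_contra hab
    refine hx (a + b) (fun h0 => hab (eq_neg_of_add_eq_zero_left h0)) ?_
    rw [linForm_add, h, neg_add_cancel]

lemma hat_neg (b : Fin (n + 1) → ℤ) : hat (-b) = -hat b := rfl

lemma IsBestApprox.eq_or_eq_neg {x : Fin n → ℝ} (hx : TotallyIrrational x)
    {a b : Fin (n + 1) → ℤ} (ha : IsBestApprox x a) (hb : IsBestApprox x b)
    (h : ‖hat a‖ = ‖hat b‖) : a = b ∨ a = -b :=
  hx.eq_or_eq_neg (le_antisymm (ha.2 b hb.1 h.ge) (hb.2 a ha.1 h.le))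

lemma ne_zero_of_hat_pos {b : Fin (n + 1) → ℤ} (h : 0 < ‖hat b‖) : b ≠ 0 := by
  rintro rfl
  exact (norm_pos_iff.1 h) rfl

/-- The minimum of the form over heights up to `N + 1` is positive, and Dirichlet's theorem with a
large bound goes below it; a minimiser for that bound must be higher than `N`. -/
lemma TotallyIrrational.exists_isBestApprox_gt (hn : 1 ≤ n) {x : Fin n → ℝ}
    (hx : TotallyIrrational x) (N : ℕ) : ∃ q, IsBestApprox x q ∧ (N : ℝ) < ‖hat q‖ := by
  obtain ⟨q₀, hq₀, -, hmin⟩ := exists_isBestApprox_le hn x (N + 1) (by omega)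
  have hpos : 0 < |linForm x q₀| := abs_pos.2 (hx _ (ne_zero_of_hat_pos hq₀.1))
  obtain ⟨M, hM⟩ := exists_nat_gt (1 / |linForm x q₀|)
  have hM0 : (0 : ℝ) < M := lt_trans (by positivity) hM
  have hM1 : 1 ≤ M := by exact_mod_cast hM0
  obtain ⟨b, hb, hbM, hbL⟩ := exists_linForm_le hn x M hM1
  obtain ⟨q, hq, hqM, hqmin⟩ := exists_isBestApprox_le hn x M hM1
  refine ⟨q, hq, ?_⟩
  by_contra hle
  have h1 := hmin q hq.1 (by push_cast; linarith)
  have h2 := (hqmin b hb hbM).trans hbL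
  have h3 : 1 / (M : ℝ) ^ n ≤ 1 / M := by
    gcongr
    exact le_self_pow₀ (by exact_mod_cast hM1) (by omega)
  have h4 : 1 / (M : ℝ) < |linForm x q₀| := by
    rw [div_lt_comm₀ hM0 hpos]; exact hM
  linarith

lemma TotallyIrrational.exists_isBestApproxSeq (hn : 1 ≤ n) {x : Fin n → ℝ}
    (hx : TotallyIrrational x) : ∃ q, IsBestApproxSeq x q := by
  let S : Set ℕ := {h | ∃ q, IsBestApprox x q ∧ height (hat q) = h}
  have hS : S.Infinite := by
    refine Set.infinite_of_not_bddAbove ?_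
    rintro ⟨N, hN⟩
    obtain ⟨q, hq, hlt⟩ := hx.exists_isBestApprox_gt hn N
    rw [norm_eq_height, Nat.cast_lt] at hlt
    exact absurd (hN ⟨q, hq, rfl⟩) (not_le.2 hlt)
  have := hS.to_subtype
  classical
  let e : ℕ ≃o S := Nat.Subtype.orderIsoOfNat S
  choose q hq hqh using fun j => (e j).2
  refine ⟨q, hq, ?_, fun b hb => ?_⟩
  · intro i j hij
    simp only [norm_eq_height, hqh]
    exact_mod_cast e.strictMono hij
  · obtain ⟨j, hj⟩ := e.surjective ⟨height (hat b), b, hb, rfl⟩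
    refine ⟨j, hb.eq_or_eq_neg hx (hq j) ?_⟩
    rw [norm_eq_height, norm_eq_height, hqh, hj]

lemma IsBestApproxSeq.le_norm {x : Fin n → ℝ} {q : ℕ → Fin (n + 1) → ℤ}
    (hq : IsBestApproxSeq x q) (j : ℕ) : (j : ℝ) ≤ ‖hat (q j)‖ := by
  have h : StrictMono fun j => height (hat (q j)) := fun i j hij => by
    have := hq.2.1 hij
    simpa only [norm_eq_height, Nat.cast_lt] using this
  rw [norm_eq_height]
  exact_mod_cast h.id_le j

/-- A submodule of smallest rank that contains all best approximations of large norm computes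
`R x`. -/
theorem TotallyIrrational.R_eq_finrank (hn : 1 ≤ n) {x : Fin n → ℝ} (hx : TotallyIrrational x)
    (L : Submodule ℤ (Fin (n + 1) → ℤ))
    (hL : ∃ N : ℝ, ∀ q, IsBestApprox x q → N ≤ ‖hat q‖ → q ∈ L)
    (hmin : ∀ L' : Submodule ℤ (Fin (n + 1) → ℤ),
      (∃ N : ℝ, ∀ q, IsBestApprox x q → N ≤ ‖hat q‖ → q ∈ L') →
        Module.finrank ℤ L ≤ Module.finrank ℤ L') :
    R x = Module.finrank ℤ L := by
  refine IsLeast.csInf_eq ⟨?_, ?_⟩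
  -- Existence of the sequence matters: without it the set would be empty and its `sInf` would be
  -- `0`.
  · obtain ⟨q, hq⟩ := hx.exists_isBestApproxSeq hn
    obtain ⟨N, hN⟩ := hL
    obtain ⟨j₀, hj₀⟩ := exists_nat_ge N
    refine ⟨q, hq, L, rfl, j₀, fun j hj => hN _ (hq.1 j) (hj₀.trans ?_)⟩
    exact le_trans (by exact_mod_cast hj) (hq.le_norm j)
  · rintro _ ⟨q, hq, L', rfl, j₀, hj₀⟩
    refine hmin L' ⟨‖hat (q j₀)‖, fun b hb hle => ?_⟩
    obtain ⟨j, hj⟩ := hq.2.2 b hb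
    have hjj : j₀ ≤ j := by
      rw [← hq.2.1.le_iff_le]
      rcases hj with rfl | rfl
      · exact hle
      · simpa [hat_neg] using hle
    rcases hj with rfl | rfl
    · exact hj₀ j hjj
    · exact neg_mem (hj₀ j hjj)

/-! ### Slabs, Borel–Cantelli on coordinate slices, and Hausdorff dimension. -/

/-- The linear map replacing the coordinate `i` by the form `c` has determinant `c i` and sends the
set into a box with one side `2 * δ` and all others `1`. -/
lemma volume_slab_le {ι : Type*} [Fintype ι] (c : ι → ℝ) (i : ι) (hi : c i ≠ 0) (s δ : ℝ) :
    volume (Set.Icc (0 : ι → ℝ) 1 ∩ {z | |∑ j, c j * z j + s| ≤ δ}) ≤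
      ENNReal.ofReal (2 * (δ / |c i|)) := by
  classical
  let A : Matrix ι ι ℝ := (1 : Matrix ι ι ℝ).updateRow i c
  have hdet : A.det = c i := by
    have := congrFun (congrFun (congrArg DFunLike.coe (Matrix.cramer_one (n := ι) (α := ℝ))) c) i
    rw [Matrix.cramer_apply] at this
    rw [← Matrix.det_transpose, ← Matrix.updateCol_transpose, Matrix.transpose_one]
    exact this
  let f : (ι → ℝ) →ₗ[ℝ] (ι → ℝ) := Matrix.toLin' A
  have hf : LinearMap.det f = c i := by rw [LinearMap.det_toLin', hdet]
  have hfi : ∀ z, f z i = ∑ j, c j * z j := by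
    intro z
    simp [f, A, Matrix.mulVec, dotProduct]
  have hfj : ∀ z j, j ≠ i → f z j = z j := by
    intro z j hj
    simp [f, A, Matrix.mulVec, dotProduct, Matrix.updateRow_ne hj, Matrix.one_apply]
  let t : ι → Set ℝ := fun j => if j = i then Set.Icc (-s - δ) (-s + δ) else Set.Icc 0 1
  have hsub : Set.Icc (0 : ι → ℝ) 1 ∩ {z | |∑ j, c j * z j + s| ≤ δ} ⊆ f ⁻¹' Set.univ.pi t := by
    rintro z ⟨hz, hz'⟩ j -
    by_cases hj : j = i
    · subst hj
      simp only [t, if_true, hfi, Set.mem_Icc]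
      have := abs_le.1 (show |∑ j, c j * z j + s| ≤ δ from hz')
      constructor <;> linarith
    · simp only [t, if_neg hj, hfj z j hj]
      exact ⟨hz.1 j, hz.2 j⟩
  refine (measure_mono hsub).trans ?_
  rw [Measure.addHaar_preimage_linearMap _ (by rwa [hf]), hf, volume_pi_pi,
    Finset.prod_eq_single i (fun j _ hj => by simp [t, hj]) (by simp)]
  simp only [t, if_true, Real.volume_Icc]
  rw [← ENNReal.ofReal_mul (abs_nonneg _), abs_inv]
  apply le_of_eq
  congr 1
  ring

section Glue

variable {p : Fin n → Prop} [DecidablePred p]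

/-- The point whose coordinates satisfying `p` are those of `z`, the others being those of `y`. -/
def glue (y : Fin n → ℝ) (z : {i // p i} → ℝ) : Fin n → ℝ :=
  fun i => if h : p i then z ⟨i, h⟩ else y i

lemma linForm_glue (y : Fin n → ℝ) (z : {i // p i} → ℝ) (q : Fin (n + 1) → ℤ) :
    linForm (glue y z) q = ∑ j : {i // p i}, (q j.1.castSucc : ℝ) * z j +
      (∑ j : {i // ¬ p i}, (q j.1.castSucc : ℝ) * y j + q (Fin.last n)) := by
  rw [linForm, ← add_assoc, ← Fintype.sum_subtype_add_sum_subtype p]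
  congr 2
  · exact Finset.sum_congr rfl fun j _ => by simp [glue, j.2]
  · exact Finset.sum_congr rfl fun j _ => by simp [glue, j.2]

/-- The image of `L` in real space is discrete, since distinct integer vectors are at distance at
least `1`; lattice sums converge beyond the rank. -/
lemma summable_norm_inv_pow (L : Submodule ℤ (Fin n → ℤ)) (w : ℕ)
    (hw : Module.finrank ℤ L < w) : Summable fun q : L => ‖(q : Fin n → ℤ)‖⁻¹ ^ w := by
  let f : (Fin n → ℤ) →ₗ[ℤ] (Fin n → ℝ) := (Algebra.linearMap ℤ ℝ).compLeft (Fin n)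
  have hfn : ∀ q, ‖f q‖ = ‖q‖ := by
    intro q
    refine congrArg NNReal.toReal (Finset.sup_congr rfl fun b _ => ?_)
    simp [f, ← NNReal.coe_inj, Int.norm_eq_abs]
  have hf : Function.Injective f := by
    rw [← LinearMap.ker_eq_bot, LinearMap.ker_eq_bot']
    intro q hq
    rw [← norm_eq_zero, ← hfn, hq, norm_zero]
  have : DiscreteTopology (L.map f) := by
    refine DiscreteTopology.of_forall_le_dist one_pos ?_
    rintro ⟨_, a, ha, rfl⟩ ⟨_, b, hb, rfl⟩ huv
    rw [Subtype.dist_eq, dist_eq_norm, ← map_sub, hfn]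
    refine one_le_norm_of_pos (norm_pos_iff.2 (sub_ne_zero.2 fun hab => huv ?_))
    exact Subtype.ext (congrArg f hab)
  let e := Submodule.equivMapOfInjective f hf L
  have hs := ZLattice.summable_norm_pow_inv (L.map f) w (by rwa [← e.finrank_eq])
  refine (e.toEquiv.summable_iff.2 hs).congr fun q => ?_
  change ‖f q‖⁻¹ ^ w = _
  rw [hfn]

/-- Borel–Cantelli: each `q` excludes a slab of volume at most `2 * |C| * ‖q‖⁻¹ ^ w`, and `w`
exceeds the rank of `L`. -/
lemma ae_finite_linForm_le (y : Fin n → ℝ) (L : Submodule ℤ (Fin (n + 1) → ℤ)) (w : ℕ)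
    (hw : Module.finrank ℤ L < w) (C : ℝ) (δ : (Fin (n + 1) → ℤ) → ℝ)
    (s : Set (Fin (n + 1) → ℤ))
    (hs : ∀ q ∈ s, q ∈ L ∧ ∃ i, p i ∧ q (Fin.castSucc i) ≠ 0 ∧
      δ q / |(q (Fin.castSucc i) : ℝ)| ≤ C * ‖q‖⁻¹ ^ w) :
    ∀ᵐ z ∂(volume.restrict (Set.Icc (0 : {i // p i} → ℝ) 1)),
      {q | q ∈ s ∧ |linForm (glue y z) q| ≤ δ q}.Finite := by
  let E : L → Set ({i // p i} → ℝ) := fun q => {z | (q : Fin (n + 1) → ℤ) ∈ s ∧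
    |linForm (glue y z) q| ≤ δ q}
  have hE : ∀ q : L, volume.restrict (Set.Icc (0 : {i // p i} → ℝ) 1) (E q) ≤
      ENNReal.ofReal (2 * |C| * ‖(q : Fin (n + 1) → ℤ)‖⁻¹ ^ w) := by
    intro q
    by_cases hq : (q : Fin (n + 1) → ℤ) ∈ s
    · obtain ⟨-, i, hi, hqi, hle⟩ := hs q hq
      rw [Measure.restrict_apply' measurableSet_Icc, Set.inter_comm]
      refine le_trans (measure_mono ?_) ((volume_slab_le (fun j : {i // p i} =>
        ((q : Fin (n + 1) → ℤ) j.1.castSucc : ℝ)) ⟨i, hi⟩ (by exact_mod_cast hqi)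
        (∑ j : {i // ¬ p i}, ((q : Fin (n + 1) → ℤ) j.1.castSucc : ℝ) * y j +
          (q : Fin (n + 1) → ℤ) (Fin.last n)) (δ q)).trans ?_)
      · refine Set.inter_subset_inter_right _ fun z hz => ?_
        have := hz.2
        rwa [linForm_glue] at this
      · refine ENNReal.ofReal_le_ofReal ?_
        have : C * ‖(q : Fin (n + 1) → ℤ)‖⁻¹ ^ w ≤ |C| * ‖(q : Fin (n + 1) → ℤ)‖⁻¹ ^ w := by
          gcongr
          exact le_abs_self C
        dsimp only
        linarith
    · have : E q = ∅ := by
        ext z; simp [E, hq]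
      simp [this]
  have hsum : ∑' q : L, volume.restrict (Set.Icc (0 : {i // p i} → ℝ) 1) (E q) ≠ ⊤ := by
    refine ne_top_of_le_ne_top ?_ (ENNReal.tsum_le_tsum hE)
    exact ((summable_norm_inv_pow L w hw).mul_left (2 * |C|)).tsum_ofReal_ne_top
  filter_upwards [ae_finite_setOfPred_mem hsum] with z hz
  refine (hz.image Subtype.val).subset ?_
  rintro q ⟨hq, hq'⟩
  exact ⟨⟨q, (hs q hq).1⟩, ⟨hq, hq'⟩, rfl⟩

/-- Projection to the free coordinates is Lipschitz, so it does not raise dimension, and its image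
of `S` has positive Lebesgue measure. -/
lemma dimH_pos_of_ae_glue_mem (y : Fin n → ℝ) [Nonempty {i // p i}] (S : Set (Fin n → ℝ))
    (h : ∀ᵐ z ∂(volume.restrict (Set.Icc (0 : {i // p i} → ℝ) 1)), glue y z ∈ S) :
    0 < dimH S := by
  let π : (Fin n → ℝ) → ({i // p i} → ℝ) := fun x j => x j
  have hπ : LipschitzWith 1 π := by
    refine LipschitzWith.of_dist_le_mul fun a b => ?_
    rw [NNReal.coe_one, one_mul, dist_pi_le_iff dist_nonneg]
    exact fun j => dist_le_pi_dist a b j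
  let A : Set ({i // p i} → ℝ) := {z | glue y z ∈ S}
  have hA : A ⊆ π '' S := fun z hz => ⟨glue y z, hz, by ext j; simp [π, glue, j.2]⟩
  have hvol : volume A ≠ 0 := by
    intro h0
    have h1 : ∀ᵐ z ∂(volume.restrict (Set.Icc (0 : {i // p i} → ℝ) 1)), z ∉ A :=
      ae_restrict_of_ae (measure_eq_zero_iff_ae_notMem.1 h0)
    have h2 : ∀ᵐ z ∂(volume.restrict (Set.Icc (0 : {i // p i} → ℝ) 1)), False := by
      filter_upwards [h, h1] with z hz hz'
      exact hz' hz
    rw [Filter.eventually_false_iff_eq_bot, ae_eq_bot, Measure.restrict_eq_zero,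
      Real.volume_Icc_pi] at h2
    simp at h2
  have hdim : ((Fintype.card {i // p i} : ℕ) : ENNReal) ≤ dimH A := by
    have := le_dimH_of_hausdorffMeasure_ne_zero (s := A) (d := (Fintype.card {i // p i} : ℕ))
      (by rw [NNReal.coe_natCast, hausdorffMeasure_pi_real]; exact hvol)
    simpa using this
  calc (0 : ENNReal) < (Fintype.card {i // p i} : ℕ) := by exact_mod_cast Fintype.card_pos
    _ ≤ dimH A := hdim
    _ ≤ dimH (π '' S) := dimH_mono hA
    _ ≤ dimH S := hπ.dimH_image_le S

end Glue

lemma exists_abs_eq_norm {ι : Type*} [Fintype ι] {v : ι → ℤ} (h : 0 < ‖v‖) :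
    ∃ i, |(v i : ℝ)| = ‖v‖ := by
  have : Nonempty ι := by
    by_contra hι
    rw [not_nonempty_iff] at hι
    rw [Subsingleton.elim v 0, norm_zero] at h
    exact h.false
  obtain ⟨i, -, hi⟩ := Finset.exists_mem_eq_sup Finset.univ Finset.univ_nonempty
    fun i => (v i).natAbs
  refine ⟨i, ?_⟩
  rw [norm_eq_height, height, hi, Nat.cast_natAbs, Int.cast_abs]

section Glue

variable {p : Fin n → Prop} [DecidablePred p]

lemma ae_linForm_ne_zero (y : Fin n → ℝ) :
    ∀ᵐ z ∂(volume.restrict (Set.Icc (0 : {i // p i} → ℝ) 1)), ∀ q : Fin (n + 1) → ℤ,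
      (∃ i, p i ∧ q (Fin.castSucc i) ≠ 0) → linForm (glue y z) q ≠ 0 := by
  rw [ae_all_iff]
  intro q
  by_cases hq : ∃ i, p i ∧ q (Fin.castSucc i) ≠ 0
  · obtain ⟨i, hi, hqi⟩ := hq
    have h0 := volume_slab_le (fun j : {i // p i} => (q j.1.castSucc : ℝ)) ⟨i, hi⟩
      (by exact_mod_cast hqi)
      (∑ j : {i // ¬ p i}, (q j.1.castSucc : ℝ) * y j + q (Fin.last n)) 0
    rw [zero_div, mul_zero, ENNReal.ofReal_zero, nonpos_iff_eq_zero] at h0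
    rw [ae_restrict_iff' measurableSet_Icc]
    filter_upwards [measure_eq_zero_iff_ae_notMem.1 h0] with z hz hz' _ h
    refine hz ⟨hz', ?_⟩
    rw [linForm_glue] at h
    simp only [Set.mem_ofPred_eq]
    rw [h, abs_zero]
  · exact Filter.Eventually.of_forall fun z h => absurd h hq

end Glue

/-! ### Generic points: full rank, and lower bounds for the form. -/

instance : Countable (Submodule ℤ (Fin n → ℤ)) := by
  refine Function.Surjective.countable
    (f := fun s : Finset (Fin n → ℤ) => Submodule.span ℤ (s : Set (Fin n → ℤ))) fun L => ?_
  exact IsNoetherian.noetherian L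

lemma norm_le_mul_norm_hat {x : Fin n → ℝ} {q : Fin (n + 1) → ℤ} {K : ℝ}
    (hK : ∑ i, |x i| + 2 ≤ K) (hq : 0 < ‖hat q‖) (h : |linForm x q| ≤ 1) :
    ‖q‖ ≤ K * ‖hat q‖ := by
  have h1 := one_le_norm_of_pos hq
  have h2 := norm_le_of_hat x q
  nlinarith

lemma inv_pow_le_of_norm_le {q : Fin (n + 1) → ℤ} {K : ℝ} (hq : 0 < ‖hat q‖)
    (h : ‖q‖ ≤ K * ‖hat q‖) (w : ℕ) : 1 / ‖hat q‖ ^ w ≤ K ^ w * ‖q‖⁻¹ ^ w := by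
  have hq0 : 0 < ‖q‖ := norm_pos_iff.2 (ne_zero_of_hat_pos hq)
  rw [← mul_pow, ← one_div_pow]
  have : 1 / ‖hat q‖ ≤ K * ‖q‖⁻¹ := by
    rw [← div_eq_mul_inv, div_le_div_iff₀ hq hq0]
    linarith
  gcongr

/-- For almost every `x`, no tail of the best approximations lies in a proper sublattice. -/
lemma ae_R_eq (hn : 1 ≤ n) :
    ∀ᵐ z ∂(volume.restrict (Set.Icc (0 : {_i : Fin n // True} → ℝ) 1)),
      TotallyIrrational (glue 0 z) ∧ R (glue 0 z) = n + 1 := by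
  have hA : ∀ᵐ z ∂(volume.restrict (Set.Icc (0 : {i : Fin n // True} → ℝ) 1)),
      -- The constant comparing `‖q‖` with `‖hat q‖` depends on the point; letting it range over
      -- naturals keeps the exceptional sets countable in number.
      ∀ (L : Submodule ℤ (Fin (n + 1) → ℤ)) (K : ℕ), Module.finrank ℤ L < n + 1 →
      {q | q ∈ {q | q ∈ L ∧ 0 < ‖hat q‖ ∧ ‖q‖ ≤ K * ‖hat q‖} ∧
        |linForm (glue 0 z) q| ≤ 1 / ‖hat q‖ ^ n}.Finite := by
    rw [ae_all_iff]
    intro L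
    rw [ae_all_iff]
    intro K
    by_cases hL : Module.finrank ℤ L < n + 1
    · refine (ae_finite_linForm_le (p := fun _ : Fin n => True) 0 L (n + 1) hL
        ((K : ℝ) ^ (n + 1)) (fun q => 1 / ‖hat q‖ ^ n)
        {q | q ∈ L ∧ 0 < ‖hat q‖ ∧ ‖q‖ ≤ K * ‖hat q‖} ?_).mono fun z hz _ => hz
      rintro q ⟨hqL, hq, hle⟩
      -- All coordinates are free, so the slab can be cut along the largest one; this raises the
      -- decay from `n` to `n + 1`.
      obtain ⟨i, hi⟩ := exists_abs_eq_norm hq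
      refine ⟨hqL, i, trivial, ?_, ?_⟩
      · intro h0
        have : hat q i = 0 := h0
        rw [this, Int.cast_zero, abs_zero] at hi
        exact hq.ne hi
      · have hi' : |(q i.castSucc : ℝ)| = ‖hat q‖ := hi
        rw [hi', div_div, ← pow_succ]
        exact inv_pow_le_of_norm_le hq hle _
    · exact Filter.Eventually.of_forall fun z h => absurd h hL
  filter_upwards [hA, ae_linForm_ne_zero (p := fun _ : Fin n => True) 0] with z hz hz'
  have hirr : TotallyIrrational (glue (p := fun _ : Fin n => True) 0 z) := by
    intro q hq
    by_cases h : ∃ i : Fin n, True ∧ q (Fin.castSucc i) ≠ 0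
    · exact hz' q h
    · push Not at h
      have hsum : linForm (glue (p := fun _ : Fin n => True) 0 z) q = q (Fin.last n) := by
        simp [linForm, fun i => h i trivial]
      rw [hsum]
      intro h0
      refine hq (funext fun i => ?_)
      refine Fin.lastCases ?_ (fun i => h i trivial) i
      exact_mod_cast h0
  refine ⟨hirr, ?_⟩
  rw [hirr.R_eq_finrank hn ⊤ ⟨0, fun _ _ _ => Submodule.mem_top⟩, finrank_top,
    Module.finrank_fin_fun]
  rintro L ⟨N, hN⟩
  rw [finrank_top, Module.finrank_fin_fun]
  by_contra! hlt
  obtain ⟨K, hK⟩ := exists_nat_ge (∑ i, |glue (p := fun _ : Fin n => True) 0 z i| + 2)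
  obtain ⟨M, hM⟩ := ((hz L K hlt).image fun q => ‖hat q‖).bddAbove
  obtain ⟨M', hM'⟩ := exists_nat_ge (max M N)
  obtain ⟨q, hq, hlt'⟩ := hirr.exists_isBestApprox_gt hn M'
  have hMN := max_le_iff.1 hM'
  have hle := hq.abs_linForm_le hn
  have h1 : |linForm (glue (p := fun _ : Fin n => True) 0 z) q| ≤ 1 := by
    refine hle.trans (div_le_one_of_le₀ (one_le_pow₀ (one_le_norm_of_pos hq.1)) ?_)
    positivity
  have := hM ⟨q, ⟨⟨hN q hq (by linarith [hMN.2]), hq.1, norm_le_mul_norm_hat hK hq.1 h1⟩, hle⟩, rfl⟩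
  dsimp only at this
  linarith [hMN.1]

/-- Almost everywhere on a coordinate slice, the linear form is polynomially bounded below at
the integer vectors that involve a free coordinate. -/
lemma ae_exists_le_linForm {p : Fin n → Prop} [DecidablePred p] (y : Fin n → ℝ) :
    ∀ᵐ z ∂(volume.restrict (Set.Icc (0 : {i // p i} → ℝ) 1)),
      ∃ c : ℝ, 0 < c ∧ ∀ q : Fin (n + 1) → ℤ, (∃ i, p i ∧ q (Fin.castSucc i) ≠ 0) →
        c ≤ |linForm (glue y z) q| * ‖hat q‖ ^ (n + 2) := by
  have hA : ∀ᵐ z ∂(volume.restrict (Set.Icc (0 : {i // p i} → ℝ) 1)), ∀ K : ℕ,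
      {q | q ∈ {q | (∃ i, p i ∧ q (Fin.castSucc i) ≠ 0) ∧ ‖q‖ ≤ K * ‖hat q‖} ∧
        |linForm (glue y z) q| ≤ 1 / ‖hat q‖ ^ (n + 2)}.Finite := by
    rw [ae_all_iff]
    intro K
    -- The free coefficient may be as small as `1` and gives no extra decay, so the exponent itself
    -- must exceed the full rank `n + 1`.
    refine ae_finite_linForm_le y ⊤ (n + 2) ?_ ((K : ℝ) ^ (n + 2)) _ _ ?_
    · rw [finrank_top, Module.finrank_fin_fun]
      omega
    · rintro q ⟨⟨i, hi, hqi⟩, hle⟩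
      refine ⟨Submodule.mem_top, i, hi, hqi, ?_⟩
      have hq1 : (1 : ℝ) ≤ |(q i.castSucc : ℝ)| := by exact_mod_cast Int.one_le_abs hqi
      have hq : 0 < ‖hat q‖ := lt_of_lt_of_le one_pos (hq1.trans (abs_le_norm (hat q) i))
      refine le_trans (div_le_self (by positivity) hq1) ?_
      exact inv_pow_le_of_norm_le hq hle _
  filter_upwards [hA, ae_linForm_ne_zero (p := p) y] with z hz hz'
  obtain ⟨K, hK⟩ := exists_nat_ge (∑ i, |glue y z i| + 2)
  set T := {q | q ∈ {q | (∃ i, p i ∧ q (Fin.castSucc i) ≠ 0) ∧ ‖q‖ ≤ K * ‖hat q‖} ∧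
        |linForm (glue y z) q| ≤ 1 / ‖hat q‖ ^ (n + 2)} with hT
  have hpos : ∀ q : Fin (n + 1) → ℤ, (∃ i, p i ∧ q (Fin.castSucc i) ≠ 0) → 0 < ‖hat q‖ := by
    rintro q ⟨i, -, hi⟩
    exact norm_pos_iff.2 fun h => hi (congrFun h i)
  have hout : ∀ q : Fin (n + 1) → ℤ, (∃ i, p i ∧ q (Fin.castSucc i) ≠ 0) → q ∉ T →
      1 ≤ |linForm (glue y z) q| * ‖hat q‖ ^ (n + 2) := by
    intro q hq hqT
    have hq0 := hpos q hq
    by_contra! hlt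
    rw [← lt_div_iff₀ (by positivity)] at hlt
    refine hqT ⟨⟨hq, norm_le_mul_norm_hat hK hq0 (hlt.le.trans ?_)⟩, hlt.le⟩
    exact div_le_one_of_le₀ (one_le_pow₀ (one_le_norm_of_pos hq0)) (by positivity)
  rcases T.eq_empty_or_nonempty with hE | hE
  · exact ⟨1, one_pos, fun q hq => hout q hq (by simp [hE])⟩
  · obtain ⟨q₀, hq₀, hmin⟩ := Set.exists_min_image T
      (fun q => |linForm (glue y z) q| * ‖hat q‖ ^ (n + 2)) (hz K) hE
    refine ⟨min 1 (|linForm (glue y z) q₀| * ‖hat q₀‖ ^ (n + 2)), lt_min one_pos ?_, ?_⟩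
    · have := hpos q₀ hq₀.1.1
      have := abs_pos.2 (hz' q₀ hq₀.1.1)
      positivity
    · intro q hq
      by_cases hqT : q ∈ T
      · exact (min_le_right _ _).trans (hmin q hqT)
      · exact (min_le_left _ _).trans (hout q hq hqT)

/-! ### Lacunary series with bounded integer numerators. -/

/-- A sequence of denominators, each of which is the `g`-th power of the preceding one. -/
def denom (g k : ℕ) : ℕ := 2 ^ g ^ k

lemma denom_pos (g k : ℕ) : (0 : ℝ) < denom g k := by
  simp [denom]

lemma denom_succ (g k : ℕ) : denom g (k + 1) = denom g k ^ g := by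
  rw [denom, denom, ← pow_mul, pow_succ]

lemma two_le_denom {g : ℕ} (hg : 4 ≤ g) (k : ℕ) : 2 ≤ denom g k :=
  le_self_pow₀ (a := 2) (by norm_num) (pow_pos (by omega) k).ne'

lemma denom_mono {g : ℕ} (hg : 4 ≤ g) : Monotone (denom g) :=
  fun _ _ h => Nat.pow_le_pow_right (by norm_num) (Nat.pow_le_pow_right (by omega) h)

/-- The gap that makes series arithmetic rigid: numerators up to `denom g k` leave a tail after `k`
of at most `1 / (2 * denom g k)`. -/
lemma four_mul_denom_sq_le {g : ℕ} (hg : 4 ≤ g) (k : ℕ) :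
    (4 : ℝ) * denom g k ^ 2 ≤ denom g (k + 1) := by
  have h2 := two_le_denom hg k
  have h : 4 * denom g k ^ 2 ≤ denom g (k + 1) := by
    rw [denom_succ]
    calc 4 * denom g k ^ 2 ≤ denom g k ^ 2 * denom g k ^ 2 := by gcongr; nlinarith
      _ = denom g k ^ 4 := by ring
      _ ≤ denom g k ^ g := Nat.pow_le_pow_right (by omega) hg
  exact_mod_cast h

lemma two_pow_mul_denom_le {g : ℕ} (hg : 4 ≤ g) (K j : ℕ) :
    (2 : ℝ) ^ j * denom g K ≤ denom g (j + K) := by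
  induction j with
  | zero => simp
  | succ j ih =>
    have h2 : (2 : ℝ) ≤ denom g (j + K) := by exact_mod_cast two_le_denom hg (j + K)
    have := four_mul_denom_sq_le hg (j + K)
    rw [show j + 1 + K = j + K + 1 by ring, pow_succ]
    nlinarith

lemma two_pow_le_denom {g : ℕ} (hg : 4 ≤ g) (k : ℕ) : (2 : ℝ) ^ k ≤ denom g k := by
  have h1 := two_pow_mul_denom_le hg 0 k
  have h2 : (1 : ℝ) ≤ denom g 0 := by exact_mod_cast one_le_two.trans (two_le_denom hg 0)
  rw [add_zero] at h1
  exact (le_mul_of_one_le_right (by positivity) h2).trans h1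

lemma natCast_le_denom {g : ℕ} (hg : 4 ≤ g) (k : ℕ) : (k : ℝ) ≤ denom g k := by
  refine le_trans ?_ (two_pow_le_denom hg k)
  exact_mod_cast (Nat.lt_two_pow_self (n := k)).le

/-- The tail, starting at index `K`, of the series with numerators `e`. -/
noncomputable def tail (g : ℕ) (e : ℕ → ℤ) (K : ℕ) : ℝ :=
  ∑' j, (e (j + K) : ℝ) / denom g (j + K)

section Series

variable {g : ℕ} (hg : 4 ≤ g) {e : ℕ → ℤ} {B : ℝ} (he : ∀ j, |(e j : ℝ)| ≤ B)

include hg he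

lemma abs_div_denom_le (K j : ℕ) :
    ‖(e (j + K) : ℝ) / denom g (j + K)‖ ≤ B / denom g K * (1 / 2) ^ j := by
  have hB : 0 ≤ B := (abs_nonneg _).trans (he 0)
  have hD := denom_pos g K
  rw [Real.norm_eq_abs, abs_div, Nat.abs_cast, one_div, inv_pow, ← div_eq_mul_inv, div_div]
  refine div_le_div₀ hB (he _) (by positivity) ?_
  rw [mul_comm]
  exact two_pow_mul_denom_le hg K j

lemma summable_div_denom (K : ℕ) : Summable fun j => (e (j + K) : ℝ) / denom g (j + K) :=
  Summable.of_norm_bounded (summable_geometric_two.mul_left _) (abs_div_denom_le hg he K)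

lemma abs_tail_le (K : ℕ) : |tail g e K| ≤ 2 * B / denom g K := by
  have h := tsum_of_norm_bounded (summable_geometric_two.hasSum.mul_left (B / denom g K))
    (abs_div_denom_le hg he K)
  rw [tsum_geometric_two] at h
  rw [← Real.norm_eq_abs]
  exact h.trans (le_of_eq (by ring))

lemma tail_eq_add (K : ℕ) : tail g e K = (e K : ℝ) / denom g K + tail g e (K + 1) := by
  rw [tail, (summable_div_denom hg he K).tsum_eq_zero_add, zero_add, tail]
  congr 1
  refine tsum_congr fun j => ?_
  rw [show j + 1 + K = j + (K + 1) by ring]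

lemma tail_zero_eq (K : ℕ) :
    tail g e 0 = ∑ j ∈ Finset.range K, (e j : ℝ) / denom g j + tail g e K := by
  induction K with
  | zero => simp
  | succ K ih => rw [ih, Finset.sum_range_succ, tail_eq_add hg he K, add_assoc]

lemma tail_eq_of_forall_eq_zero {K J : ℕ} (hKJ : K ≤ J) (h0 : ∀ j, K ≤ j → j < J → e j = 0) :
    tail g e K = tail g e J := by
  induction J, hKJ using Nat.le_induction with
  | base => rfl
  | succ J hKJ ih =>
    rw [ih fun j h1 h2 => h0 j h1 (by omega), tail_eq_add hg he J, h0 J hKJ (by omega)]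
    simp

omit he in
/-- The first nonzero term dominates the tail. -/
lemma le_abs_tail {k J : ℕ} (he : ∀ j, |(e j : ℝ)| ≤ denom g k) (hkJ : k < J)
    (h0 : ∀ j, k + 1 ≤ j → j < J → e j = 0) (hJ : e J ≠ 0) :
    1 / (2 * (denom g J : ℝ)) ≤ |tail g e (k + 1)| := by
  rw [tail_eq_of_forall_eq_zero hg he hkJ h0, tail_eq_add hg he J]
  have hD := denom_pos g J
  have h1 : 1 / (denom g J : ℝ) ≤ |(e J : ℝ) / denom g J| := by
    rw [abs_div, Nat.abs_cast]
    gcongr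
    exact_mod_cast Int.one_le_abs hJ
  have h2 : |tail g e (J + 1)| ≤ 1 / (2 * (denom g J : ℝ)) := by
    refine (abs_tail_le hg he (J + 1)).trans ?_
    have hkJ' : (denom g k : ℝ) ≤ denom g J := by exact_mod_cast denom_mono hg hkJ.le
    rw [div_le_div_iff₀ (denom_pos _ _) (by positivity)]
    have := four_mul_denom_sq_le hg J
    nlinarith
  have h3 : 1 / (denom g J : ℝ) = 1 / (2 * (denom g J : ℝ)) + 1 / (2 * (denom g J : ℝ)) := by
    field_simp; norm_num
  have h4 := abs_sub_abs_le_abs_sub ((e J : ℝ) / denom g J) (-tail g e (J + 1))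
  rw [abs_neg, sub_neg_eq_add] at h4
  linarith

omit he in
/-- If the series is very close to an integer, then its head is that integer. -/
lemma head_eq_zero {k : ℕ} (he : ∀ j, |(e j : ℝ)| ≤ denom g k) (t : ℤ)
    (h : |tail g e 0 + t| < 1 / (2 * (denom g k : ℝ))) :
    ∑ j ∈ Finset.range (k + 1), (e j : ℝ) / denom g j + t = 0 := by
  set H := ∑ j ∈ Finset.range (k + 1), (e j : ℝ) / denom g j + t with hH
  have hD := denom_pos g k
  have h1 : |tail g e (k + 1)| ≤ 1 / (2 * (denom g k : ℝ)) := by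
    refine (abs_tail_le hg he (k + 1)).trans ?_
    rw [div_le_div_iff₀ (denom_pos _ _) (by positivity)]
    have := four_mul_denom_sq_le hg k
    nlinarith
  have h2 : |H| < 1 / (denom g k : ℝ) := by
    have h3 : H = (tail g e 0 + t) - tail g e (k + 1) := by
      rw [hH, tail_zero_eq hg he (k + 1)]; ring
    have h4 := abs_sub (tail g e 0 + t) (tail g e (k + 1))
    have h5 : 1 / (denom g k : ℝ) = 1 / (2 * (denom g k : ℝ)) + 1 / (2 * (denom g k : ℝ)) := by
      field_simp; norm_num
    rw [h3]
    linarith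
  -- The head times `denom g k`: an integer of absolute value below `1`.
  let A : ℤ := ∑ j ∈ Finset.range (k + 1), e j * 2 ^ (g ^ k - g ^ j) + t * denom g k
  have hA : (A : ℝ) = H * denom g k := by
    simp only [A, hH, add_mul, Finset.sum_mul]
    push_cast
    congr 1
    refine Finset.sum_congr rfl fun j hj => ?_
    have hjk : g ^ j ≤ g ^ k := Nat.pow_le_pow_right (by omega) (by
      rw [Finset.mem_range] at hj; omega)
    simp only [denom]
    push_cast
    rw [div_mul_eq_mul_div, eq_div_iff (by positivity), mul_assoc, ← pow_add,
      Nat.sub_add_cancel hjk]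
  have hA1 : |(A : ℝ)| < 1 := by
    rw [hA, abs_mul, Nat.abs_cast]
    rwa [lt_div_iff₀ hD] at h2
  have hA0 : A = 0 := by
    rw [← Int.abs_lt_one_iff]; exact_mod_cast hA1
  rw [hA0, Int.cast_zero] at hA
  exact (mul_eq_zero.1 hA.symm).resolve_right hD.ne'

end Series

/-! ### The lacunary point and its approximations. -/

/-- The coordinates of `hat q`, extended by zero to all natural indices. -/
def coef (q : Fin (n + 1) → ℤ) (i : ℕ) : ℤ :=
  if h : i < n then q (Fin.castSucc ⟨i, h⟩) else 0

lemma abs_coef_le (q : Fin (n + 1) → ℤ) (i : ℕ) : |(coef q i : ℝ)| ≤ ‖hat q‖ := by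
  rw [coef]
  split_ifs with h
  · exact abs_le_norm (hat q) ⟨i, h⟩
  · simp

/-- The point whose `i`-th coordinate is the sum of the reciprocals of the denominators with index
congruent to `i` modulo `m`. -/
noncomputable def lacunary (n g m : ℕ) : Fin n → ℝ :=
  fun i => tail g (fun j => if j % m = i then 1 else 0) 0

/-- Each index feeds exactly one coordinate, so the form becomes a single series whose numerators
are periodic modulo `m`. -/
lemma linForm_lacunary {g m : ℕ} (hg : 4 ≤ g) (hm : 1 ≤ m) (hmn : m ≤ n)
    (q : Fin (n + 1) → ℤ) :
    linForm (lacunary n g m) q = tail g (fun j => coef q (j % m)) 0 + q (Fin.last n) := by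
  rw [linForm]
  congr 1
  simp only [lacunary, tail, ← tsum_mul_left]
  rw [← Summable.tsum_finsetSum]
  · refine tsum_congr fun j => ?_
    have hj : (j + 0) % m < n := (Nat.mod_lt _ hm).trans_le hmn
    rw [Finset.sum_eq_single ⟨(j + 0) % m, hj⟩]
    · rw [coef, dif_pos hj, if_pos rfl]
      push_cast
      ring
    · intro i _ hi
      have : (j + 0) % m ≠ i := fun h => hi (Fin.ext h.symm)
      rw [if_neg this, Int.cast_zero, zero_div, mul_zero]
    · simp
  · intro i _
    refine (summable_div_denom hg (e := fun j => if j % m = i then 1 else 0) (B := 1)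
      (fun j => ?_) 0).mul_left _
    split_ifs <;> simp

/-- The numerator of the partial sum, up to index `k`, that belongs to the class of `k` modulo
`m`. -/
def num (g m k : ℕ) : ℕ :=
  ∑ j ∈ Finset.range (k + 1), if j % m = k % m then 2 ^ (g ^ k - g ^ j) else 0

lemma num_div_denom {g : ℕ} (hg : 4 ≤ g) (m k : ℕ) :
    (num g m k : ℝ) / denom g k =
      ∑ j ∈ Finset.range (k + 1), if j % m = k % m then 1 / (denom g j : ℝ) else 0 := by
  rw [num, Nat.cast_sum, Finset.sum_div]
  refine Finset.sum_congr rfl fun j hj => ?_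
  have hjk : g ^ j ≤ g ^ k := Nat.pow_le_pow_right (by omega) (by
    rw [Finset.mem_range] at hj; omega)
  split_ifs
  · rw [div_eq_div_iff (denom_pos g k).ne' (denom_pos g j).ne']
    simp only [denom]
    push_cast
    rw [← pow_add, Nat.sub_add_cancel hjk, one_mul]
  · simp

/-- The term `j = k` is `1` and all others are even. Thus the truncated fraction is in lowest terms.
-/
lemma odd_num {g : ℕ} (hg : 4 ≤ g) (m k : ℕ) : Odd (num g m k) := by
  rw [num, Finset.sum_range_succ, if_pos rfl, Nat.sub_self, pow_zero]
  refine Even.add_odd ?_ odd_one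
  refine Finset.even_sum _ fun j hj => ?_
  split_ifs
  · have : g ^ j < g ^ k := Nat.pow_lt_pow_right (by omega) (Finset.mem_range.1 hj)
    exact (even_two).pow_of_ne_zero (by omega)
  · exact Even.zero

/-- The integer vector of the relation satisfied by the partial sums up to index `k`. -/
def approx (n g m k : ℕ) : Fin (n + 1) → ℤ :=
  Fin.snoc (α := fun _ => ℤ) (fun i : Fin n => if (i : ℕ) = k % m then (denom g k : ℤ) else 0)
    (-(num g m k : ℤ))

lemma approx_castSucc (g m k : ℕ) (i : Fin n) :
    approx n g m k i.castSucc = if (i : ℕ) = k % m then (denom g k : ℤ) else 0 := by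
  simp [approx]

lemma approx_last (g m k : ℕ) : approx n g m k (Fin.last n) = -(num g m k : ℤ) := by
  simp [approx]

section Lacunary

variable {g m : ℕ} (hg : 4 ≤ g) (hm : 2 ≤ m) (hmn : m ≤ n)

include hm hmn

lemma norm_hat_approx (k : ℕ) : ‖hat (approx n g m k)‖ = denom g k := by
  apply le_antisymm
  · rw [pi_norm_le_iff_of_nonneg (denom_pos g k).le]
    intro i
    rw [hat, approx_castSucc, Int.norm_eq_abs]
    split_ifs <;> simp
  · have hk : k % m < n := (Nat.mod_lt _ (by omega)).trans_le hmn
    have := abs_le_norm (hat (approx n g m k)) ⟨k % m, hk⟩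
    rw [hat, approx_castSucc, if_pos rfl, Int.cast_natCast, Nat.abs_cast] at this
    exact this

lemma coef_approx (k j : ℕ) :
    coef (approx n g m k) (j % m) = if j % m = k % m then (denom g k : ℤ) else 0 := by
  have hj : j % m < n := (Nat.mod_lt _ (by omega)).trans_le hmn
  rw [coef, dif_pos hj, approx_castSucc]

include hg

/-- The head cancels the last coordinate, and the next index in the residue class of `k` is `k + m`.
-/
lemma abs_linForm_approx_le (k : ℕ) :
    |linForm (lacunary n g m) (approx n g m k)| ≤ 2 * denom g k / denom g (k + m) := by
  have he : ∀ j, |(coef (approx n g m k) (j % m) : ℝ)| ≤ denom g k := fun j => by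
    rw [← norm_hat_approx hm hmn (g := g) k]
    exact abs_coef_le _ _
  have hhead : ∑ j ∈ Finset.range (k + 1), (coef (approx n g m k) (j % m) : ℝ) / denom g j =
      num g m k := by
    rw [← div_mul_cancel₀ (num g m k : ℝ) (denom_pos g k).ne', num_div_denom hg, Finset.sum_mul]
    refine Finset.sum_congr rfl fun j _ => ?_
    rw [coef_approx hm hmn]
    split_ifs
    · rw [Int.cast_natCast]; ring
    · simp
  rw [linForm_lacunary hg (by omega) hmn, tail_zero_eq hg he (k + 1), hhead, approx_last,
    tail_eq_of_forall_eq_zero hg he (show k + 1 ≤ k + m by omega)]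
  · have := abs_tail_le hg he (k + m)
    push_cast
    rwa [add_right_comm, add_neg_cancel, zero_add]
  · intro j h1 h2
    rw [coef_approx hm hmn, if_neg]
    intro h
    have := (Nat.modEq_iff_dvd' (show k ≤ j by omega)).1 h.symm
    have := Nat.le_of_dvd (by omega) this
    omega

lemma abs_linForm_approx_le_of_lt {k J : ℕ} (hkJ : k ≤ J) (hJ : J < k + m) :
    |linForm (lacunary n g m) (approx n g m k)| ≤ 1 / (2 * (denom g J : ℝ)) := by
  refine (abs_linForm_approx_le hg hm hmn k).trans ?_
  rw [div_le_div_iff₀ (denom_pos _ _) (mul_pos two_pos (denom_pos _ _))]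
  have h1 : (denom g k : ℝ) ≤ denom g J := by exact_mod_cast denom_mono hg hkJ
  have h2 : (denom g (J + 1) : ℝ) ≤ denom g (k + m) := by
    exact_mod_cast denom_mono hg (show J + 1 ≤ k + m by omega)
  have h3 := four_mul_denom_sq_le hg J
  have h4 := denom_pos g J
  nlinarith

/-- An integer vector supported on the first `m` coordinates and the last one, whose linear form
vanishes at the lacunary point, is zero. -/
lemma eq_zero_of_linForm_lacunary_eq_zero {q : Fin (n + 1) → ℤ}
    (hq : ∀ i : Fin n, m ≤ i → q i.castSucc = 0) (h : linForm (lacunary n g m) q = 0) :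
    q = 0 := by
  obtain ⟨k, hk⟩ : ∃ k : ℕ, ‖hat q‖ ≤ denom g k := by
    obtain ⟨k, hk⟩ := exists_nat_ge ‖hat q‖
    exact ⟨k, hk.trans (natCast_le_denom hg k)⟩
  have he : ∀ j, |(coef q (j % m) : ℝ)| ≤ denom g k := fun j => (abs_coef_le _ _).trans hk
  rw [linForm_lacunary hg (by omega) hmn] at h
  have hhead := head_eq_zero hg he (q (Fin.last n)) (by
    rw [h, abs_zero]; exact one_div_pos.2 (mul_pos two_pos (denom_pos _ _)))
  have htail : tail g (fun j => coef q (j % m)) (k + 1) = 0 := by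
    rw [tail_zero_eq hg he (k + 1)] at h
    linarith
  have hzero : ∀ J, k < J → coef q (J % m) = 0 := by
    intro J
    induction J using Nat.strong_induction_on with
    | _ J ih =>
      intro hkJ
      by_contra hne
      have := le_abs_tail hg he hkJ (fun j h1 h2 => ih j h2 h1) hne
      rw [htail, abs_zero] at this
      exact absurd this (not_le.2 (one_div_pos.2 (mul_pos two_pos (denom_pos _ _))))
  have hcast : ∀ i : Fin n, q i.castSucc = 0 := by
    intro i
    by_cases hi : m ≤ i
    · exact hq i hi
    -- An index beyond `k` in the residue class of `i`.
    · have := hzero (i + m * (k + 1)) (by nlinarith)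
      rw [Nat.add_mul_mod_self_left, Nat.mod_eq_of_lt (by omega), coef, dif_pos i.2] at this
      exact this
  refine funext fun i => Fin.lastCases ?_ hcast i
  have : coef q = 0 := by
    ext i
    rw [coef]
    split_ifs
    · exact hcast _
    · rfl
  simp only [this, Pi.zero_apply, Int.cast_zero, zero_div, Finset.sum_const_zero, zero_add] at hhead
  exact_mod_cast hhead

/-- Among the integer vectors supported on the first `m` coordinates and the last one, `approx` is
a best approximation. -/
lemma abs_linForm_approx_le_abs_linForm {k : ℕ} {q : Fin (n + 1) → ℤ}
    (hq : ∀ i : Fin n, m ≤ i → q i.castSucc = 0) (hpos : 0 < ‖hat q‖)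
    (hle : ‖hat q‖ ≤ denom g k) :
    |linForm (lacunary n g m) (approx n g m k)| ≤ |linForm (lacunary n g m) q| := by
  by_contra! hlt
  have hkn : k % m < n := (Nat.mod_lt _ (by omega)).trans_le hmn
  have he : ∀ j, |(coef q (j % m) : ℝ)| ≤ denom g k := fun j => (abs_coef_le _ _).trans hle
  have hlin := linForm_lacunary hg (show 1 ≤ m by omega) hmn q
  have hhead := head_eq_zero hg he (q (Fin.last n)) (by
    rw [← hlin]
    exact hlt.trans_le (abs_linForm_approx_le_of_lt hg hm hmn le_rfl (by omega)))
  have htail : linForm (lacunary n g m) q = tail g (fun j => coef q (j % m)) (k + 1) := by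
    rw [hlin, tail_zero_eq hg he (k + 1)]
    linarith
  -- A first nonzero numerator at such a `J` would make the form at least `1 / (2 * denom g J)`,
  -- which `approx` does not exceed. The window meets every residue class except that of `k`.
  have hzero : ∀ J, k < J → J < k + m → coef q (J % m) = 0 := by
    intro J
    induction J using Nat.strong_induction_on with
    | _ J ih =>
      intro hkJ hJ
      by_contra hne
      have h1 := le_abs_tail hg he hkJ (fun j h1 h2 => ih j h2 h1 (by omega)) hne
      have h2 := abs_linForm_approx_le_of_lt hg hm hmn hkJ.le hJ
      rw [← htail] at h1
      linarith
  have hcast : ∀ i : Fin n, (i : ℕ) ≠ k % m → q i.castSucc = 0 := by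
    intro i hik
    by_cases hi : m ≤ i
    · exact hq i hi
    · push Not at hi
      let d := (i + m * (k + 1) - (k + 1)) % m
      have hd : d < m := Nat.mod_lt _ (by omega)
      have hmul : k + 1 ≤ m * (k + 1) := Nat.le_mul_of_pos_left _ (by omega)
      have hmod : (k + 1 + d) % m = i := by
        rw [Nat.add_mod_mod, show k + 1 + (i + m * (k + 1) - (k + 1)) = i + m * (k + 1) by omega,
          Nat.add_mul_mod_self_left, Nat.mod_eq_of_lt hi]
      have hne : k + 1 + d ≠ k + m := by
        intro h
        rw [h, Nat.add_mod_right] at hmod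
        exact hik hmod.symm
      have := hzero (k + 1 + d) (by omega) (by omega)
      rw [hmod, coef, dif_pos i.2] at this
      exact this
  set s := coef q (k % m) with hs
  have hcoef : ∀ j, coef q (j % m) = if j % m = k % m then s else 0 := by
    intro j
    split_ifs with h
    · rw [h]
    · have hj : j % m < n := (Nat.mod_lt _ (by omega)).trans_le hmn
      rw [coef, dif_pos hj]
      exact hcast _ h
  have hrel : (s : ℝ) * num g m k + q (Fin.last n) * denom g k = 0 := by
    have h1 : ∑ j ∈ Finset.range (k + 1), (coef q (j % m) : ℝ) / denom g j =
        s * (num g m k / denom g k) := by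
      rw [num_div_denom hg, Finset.mul_sum]
      refine Finset.sum_congr rfl fun j _ => ?_
      rw [hcoef]
      split_ifs
      · ring
      · simp
    have hD := denom_pos g k
    rw [h1] at hhead
    field_simp at hhead
    linarith
  have hrel' : s * num g m k + q (Fin.last n) * denom g k = 0 := by exact_mod_cast hrel
  -- Only the class of `k` remains; lowest terms force `q` to be an integer multiple of `approx`,
  -- hence no better.
  have hcop : IsCoprime (denom g k : ℤ) (num g m k : ℤ) := by
    rw [Nat.isCoprime_iff_coprime, denom]
    exact Nat.Coprime.pow_left _ ((Nat.coprime_two_left).2 (odd_num hg m k))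
  obtain ⟨c, hc⟩ : (denom g k : ℤ) ∣ s :=
    hcop.dvd_of_dvd_mul_right ⟨-q (Fin.last n), by linarith⟩
  have hD : (denom g k : ℤ) ≠ 0 := by
    have := two_le_denom hg k
    omega
  have hlast : q (Fin.last n) = c * -(num g m k : ℤ) := by
    rw [hc] at hrel'
    apply mul_right_cancel₀ hD
    linarith
  have hqc : q = c • approx n g m k := by
    refine funext fun i => Fin.lastCases ?_ (fun i => ?_) i
    · rw [Pi.smul_apply, approx_last, hlast, smul_eq_mul]
    · rw [Pi.smul_apply, approx_castSucc, smul_eq_mul]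
      split_ifs with h
      · have hi : q i.castSucc = s := by
          rw [hs, coef, dif_pos hkn]
          congr 2
          exact Fin.ext h
        rw [hi, hc, mul_comm]
      · rw [hcast i h, mul_zero]
  have hc0 : c ≠ 0 := by
    rintro rfl
    exact ne_zero_of_hat_pos hpos (by rw [hqc, zero_smul])
  rw [hqc, linForm_smul, abs_mul] at hlt
  have : (1 : ℝ) ≤ |(c : ℝ)| := by exact_mod_cast Int.one_le_abs hc0
  nlinarith [abs_nonneg (linForm (lacunary n g m) (approx n g m k))]

/-- Each of the middle vectors is alone in its residue class. The two end vectors share a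
coordinate, but their ratios `num / denom` are successive partial sums of a positive series, hence
distinct. -/
lemma linearIndependent_approx (k : ℕ) :
    LinearIndependent ℤ fun j : Fin (m + 1) => approx n g m (k + j) := by
  rw [Fintype.linearIndependent_iff]
  intro c hc
  have hD : ∀ k, (denom g k : ℤ) ≠ 0 := fun k => by
    have := two_le_denom hg k
    omega
  have hmid : ∀ j : Fin (m + 1), (j : ℕ) ≠ 0 → (j : ℕ) ≠ m → c j = 0 := by
    intro j h0 h1
    have hj := j.2
    have hkn : (k + j) % m < n := (Nat.mod_lt _ (by omega)).trans_le hmn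
    have := congrFun hc (Fin.castSucc ⟨(k + j) % m, hkn⟩)
    rw [Finset.sum_apply, Finset.sum_eq_single j] at this
    · rw [Pi.smul_apply, approx_castSucc, if_pos rfl, smul_eq_mul, Pi.zero_apply] at this
      exact (mul_eq_zero.1 this).resolve_right (hD _)
    · intro i _ hij
      rw [Pi.smul_apply, approx_castSucc, if_neg, smul_zero]
      intro h
      have hi := i.2
      have hmod : (j : ℕ) ≡ i [MOD m] := Nat.ModEq.add_left_cancel' k h
      rcases lt_or_ge (i : ℕ) m with him | him
      · have := hmod.eq_of_lt_of_lt (by omega) him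
        exact hij (Fin.ext this.symm)
      · have him' : (i : ℕ) = m := by omega
        rw [him', Nat.modEq_iff_dvd' (by omega)] at hmod
        have := Nat.le_of_dvd (by omega) hmod
        omega
    · simp
  have hsum : c 0 • approx n g m k + c (Fin.last m) • approx n g m (k + m) = 0 := by
    rw [Fin.sum_univ_castSucc, Finset.sum_eq_single ⟨0, by omega⟩] at hc
    · simpa using hc
    · intro i _ hi
      rw [hmid i.castSucc (fun h => hi (Fin.ext h)) (by simpa using i.2.ne), zero_smul]
    · simp
  have h1 : c 0 * denom g k + c (Fin.last m) * denom g (k + m) = 0 := by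
    have hkn : k % m < n := (Nat.mod_lt _ (by omega)).trans_le hmn
    have := congrFun hsum (Fin.castSucc ⟨k % m, hkn⟩)
    simp only [Pi.add_apply, Pi.smul_apply, approx_castSucc, smul_eq_mul, Pi.zero_apply,
      Nat.add_mod_right, if_true] at this
    exact this
  have h2 : c 0 * num g m k + c (Fin.last m) * num g m (k + m) = 0 := by
    have := congrFun hsum (Fin.last n)
    simp only [Pi.add_apply, Pi.smul_apply, approx_last, smul_eq_mul, Pi.zero_apply] at this
    linarith
  have hlt : (num g m k : ℝ) / denom g k < num g m (k + m) / denom g (k + m) := by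
    rw [num_div_denom hg, num_div_denom hg, Nat.add_mod_right, Finset.sum_range_succ _ (k + m)]
    refine lt_of_le_of_lt (b := ∑ j ∈ Finset.range (k + m),
      if j % m = k % m then 1 / (denom g j : ℝ) else 0) ?_ ?_
    · refine Finset.sum_le_sum_of_subset_of_nonneg ?_ fun j _ _ => ?_
      · exact Finset.range_subset_range.2 (by omega)
      · split_ifs
        · exact (one_div_pos.2 (denom_pos _ _)).le
        · exact le_rfl
    · rw [Nat.add_mod_right, if_pos rfl]
      exact lt_add_of_pos_right _ (one_div_pos.2 (denom_pos _ _))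
  rw [div_lt_div_iff₀ (denom_pos _ _) (denom_pos _ _)] at hlt
  have hlt' : (num g m k : ℤ) * denom g (k + m) < num g m (k + m) * denom g k := by
    exact_mod_cast hlt
  have hlast : c (Fin.last m) = 0 := by
    have : c (Fin.last m) * (num g m (k + m) * denom g k - num g m k * denom g (k + m)) = 0 := by
      linear_combination (denom g k : ℤ) * h2 - (num g m k : ℤ) * h1
    exact (mul_eq_zero.1 this).resolve_right (sub_pos.2 hlt').ne'
  have h0 : c 0 = 0 := by
    rw [hlast, zero_mul, add_zero] at h1
    exact (mul_eq_zero.1 h1).resolve_right (hD _)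
  intro j
  by_cases hj0 : (j : ℕ) = 0
  · rwa [show j = 0 from Fin.ext hj0]
  · by_cases hjm : (j : ℕ) = m
    · rwa [show j = Fin.last m from Fin.ext hjm]
    · exact hmid j hj0 hjm

end Lacunary

/-! ### The coordinate lattice, and the rank on slices through the lacunary point. -/

/-- The lattice of integer vectors supported on the first `m` coordinates and the last one. -/
def coordLattice (n m : ℕ) : Submodule ℤ (Fin (n + 1) → ℤ) where
  carrier := {q | ∀ i : Fin n, m ≤ i → q i.castSucc = 0}
  add_mem' ha hb i hi := by rw [Pi.add_apply, ha i hi, hb i hi, add_zero]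
  zero_mem' _ _ := rfl
  smul_mem' c q hq i hi := by rw [Pi.smul_apply, hq i hi, smul_zero]

lemma mem_coordLattice {m : ℕ} {q : Fin (n + 1) → ℤ} :
    q ∈ coordLattice n m ↔ ∀ i : Fin n, m ≤ i → q i.castSucc = 0 := Iff.rfl

lemma finrank_coordLattice_le {m : ℕ} (hmn : m ≤ n) :
    Module.finrank ℤ (coordLattice n m) ≤ m + 1 := by
  let f : Fin (m + 1) → Fin (n + 1) :=
    Fin.snoc (α := fun _ => Fin (n + 1)) (fun i => (Fin.castLE hmn i).castSucc) (Fin.last n)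
  let φ : coordLattice n m →ₗ[ℤ] (Fin (m + 1) → ℤ) :=
    (LinearMap.funLeft ℤ ℤ f).comp (coordLattice n m).subtype
  have hφ : Function.Injective φ := by
    rw [← LinearMap.ker_eq_bot, LinearMap.ker_eq_bot']
    rintro ⟨q, hq⟩ h
    refine Subtype.ext (funext fun i => Fin.lastCases ?_ (fun i => ?_) i)
    · have := congrFun h (Fin.last m)
      simpa [φ, f] using this
    · by_cases hi : m ≤ i
      · exact hq i hi
      · have hf : f (Fin.castSucc ⟨i, by omega⟩) = i.castSucc := by
          simp only [f, Fin.snoc_castSucc]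
          rfl
        have : q (f (Fin.castSucc ⟨i, by omega⟩)) = 0 := congrFun h _
        rwa [hf] at this
  simpa using LinearMap.finrank_le_finrank_of_injective hφ

lemma linForm_glue_of_mem {m : ℕ} (y : Fin n → ℝ) (z : {i : Fin n // m ≤ i} → ℝ)
    {q : Fin (n + 1) → ℤ} (hq : q ∈ coordLattice n m) :
    linForm (glue y z) q = linForm y q := by
  rw [linForm, linForm]
  congr 1
  refine Finset.sum_congr rfl fun i _ => ?_
  by_cases hi : m ≤ i
  · rw [hq i hi, Int.cast_zero, zero_mul, zero_mul]
  · rw [glue, dif_neg hi]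

section Lacunary

variable {m : ℕ} (hm : 2 ≤ m) (hmn : m ≤ n)

include hm hmn

omit hmn in
lemma approx_mem (g k : ℕ) : approx n g m k ∈ coordLattice n m := by
  intro i hi
  rw [approx_castSucc, if_neg]
  have := Nat.mod_lt k (show 0 < m by omega)
  omega

/-- Here `m ≥ 2` enters: `D (k + m) ≥ D (k + 2) = D (k + 1) ^ (n + 4)`. Of this power, `n + 2`
offsets the generic lower bound, and the remaining square absorbs `2 * D k`. -/
lemma abs_linForm_approx_mul_le (k : ℕ) :
    |linForm (lacunary n (n + 4) m) (approx n (n + 4) m k)| * denom (n + 4) (k + 1) ^ (n + 2) ≤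
      (1 / 2) ^ k := by
  have hg : 4 ≤ n + 4 := by omega
  set D := denom (n + 4)
  have h0 := denom_pos (n + 4) k
  have h1 := denom_pos (n + 4) (k + 1)
  have h2 : (D (k + 2) : ℝ) ≤ D (k + m) := by
    exact_mod_cast denom_mono hg (show k + 2 ≤ k + m by omega)
  have h3 : (D (k + 2) : ℝ) = D (k + 1) ^ (n + 2) * D (k + 1) ^ 2 := by
    rw [← pow_add]
    exact_mod_cast denom_succ (n + 4) (k + 1)
  have h4 := four_mul_denom_sq_le hg k
  have h5 := two_pow_le_denom hg k
  have h6 : (2 : ℝ) ≤ D k := by exact_mod_cast two_le_denom hg k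
  have h7 : (2 : ℝ) ≤ D (k + 1) := by exact_mod_cast two_le_denom hg (k + 1)
  calc |linForm (lacunary n (n + 4) m) (approx n (n + 4) m k)| * D (k + 1) ^ (n + 2)
      ≤ 2 * D k / D (k + 2) * D (k + 1) ^ (n + 2) := by
        gcongr
        refine (abs_linForm_approx_le hg hm hmn k).trans ?_
        have := denom_pos (n + 4) (k + 2)
        gcongr
    _ = 2 * D k / D (k + 1) ^ 2 := by
        rw [h3]; field_simp
    _ ≤ 1 / D k := by
        rw [div_le_div_iff₀ (by positivity) h0]
        nlinarith
    _ ≤ (1 / 2) ^ k := by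
        rw [one_div_pow]
        gcongr

/-- On almost all of a coordinate slice through the lacunary point, the best approximations of
large norm span the coordinate lattice up to finite index. -/
lemma ae_glue_lacunary_mem :
    ∀ᵐ z ∂(volume.restrict (Set.Icc (0 : {i : Fin n // m ≤ i} → ℝ) 1)),
      TotallyIrrational (glue (lacunary n (n + 4) m) z) ∧
        R (glue (lacunary n (n + 4) m) z) = m + 1 := by
  have hg : 4 ≤ n + 4 := by omega
  filter_upwards [ae_exists_le_linForm (p := fun i : Fin n => m ≤ i) (lacunary n (n + 4) m),
    ae_linForm_ne_zero (p := fun i : Fin n => m ≤ i) (lacunary n (n + 4) m)] with z hz hz'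
  set y := lacunary n (n + 4) m with hy
  set x := glue y z with hx
  have hfree : ∀ {q : Fin (n + 1) → ℤ}, q ∉ coordLattice n m →
      ∃ i : Fin n, m ≤ i ∧ q i.castSucc ≠ 0 := by
    intro q hq
    rw [mem_coordLattice] at hq
    push Not at hq
    exact hq
  have hirr : TotallyIrrational x := by
    intro q hq
    by_cases h : q ∈ coordLattice n m
    · rw [hx, linForm_glue_of_mem y z h]
      exact fun h0 => hq (eq_zero_of_linForm_lacunary_eq_zero hg hm hmn h h0)
    · exact hz' q (hfree h)
  have hxa : ∀ k, linForm x (approx n (n + 4) m k) = linForm y (approx n (n + 4) m k) :=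
    fun k => linForm_glue_of_mem y z (approx_mem hm _ k)
  obtain ⟨c, hc, hcq⟩ := hz
  obtain ⟨k₀, hk₀⟩ := exists_pow_lt_of_lt_one hc (show (1 / 2 : ℝ) < 1 by norm_num)
  have hbig : ∀ k, k₀ ≤ k → ∀ q : Fin (n + 1) → ℤ, q ∉ coordLattice n m →
      ‖hat q‖ ≤ denom (n + 4) (k + 1) →
      |linForm x (approx n (n + 4) m k)| < |linForm x q| := by
    intro k hk q hq hle
    have h1 := hcq q (hfree hq)
    have h2 := abs_linForm_approx_mul_le hm hmn k
    have h3 : (1 / 2 : ℝ) ^ k ≤ (1 / 2) ^ k₀ :=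
      pow_le_pow_of_le_one (by norm_num) (by norm_num) hk
    have h4 : |linForm x q| * ‖hat q‖ ^ (n + 2) ≤
        |linForm x q| * denom (n + 4) (k + 1) ^ (n + 2) := by gcongr
    rw [hxa]
    exact lt_of_mul_lt_mul_right (by linarith) (pow_pos (denom_pos (n + 4) (k + 1)) (n + 2)).le
  have hbest : ∀ k, k₀ ≤ k → IsBestApprox x (approx n (n + 4) m k) := by
    intro k hk
    refine ⟨by rw [norm_hat_approx hm hmn]; exact denom_pos _ _, fun b hb hle => ?_⟩
    rw [norm_hat_approx hm hmn] at hle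
    by_cases h : b ∈ coordLattice n m
    · rw [hxa, hx, linForm_glue_of_mem y z h]
      exact abs_linForm_approx_le_abs_linForm hg hm hmn h hb hle
    · refine (hbig k hk b h (hle.trans ?_)).le
      exact_mod_cast denom_mono hg k.le_succ
  have hL : ∃ N : ℝ, ∀ q, IsBestApprox x q → N ≤ ‖hat q‖ → q ∈ coordLattice n m := by
    refine ⟨denom (n + 4) k₀, fun q hq hle => ?_⟩
    by_contra h
    have hex : ∃ j, ‖hat q‖ < denom (n + 4) j := by
      obtain ⟨j, hj⟩ := exists_nat_gt ‖hat q‖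
      exact ⟨j, hj.trans_le (natCast_le_denom hg j)⟩
    classical
    have hlt : k₀ < Nat.find hex := by
      rw [Nat.lt_find_iff]
      intro j hj
      refine not_lt.2 (le_trans ?_ hle)
      exact_mod_cast denom_mono hg hj
    -- With `denom k ≤ ‖hat q‖ < denom (k + 1)`, the vector `approx` at `k` is admissible against
    -- `q` and strictly better.
    obtain ⟨k, hk⟩ : ∃ k, Nat.find hex = k + 1 := ⟨Nat.find hex - 1, by omega⟩
    have h1 : ‖hat q‖ < denom (n + 4) (k + 1) := hk ▸ Nat.find_spec hex
    have h2 : (denom (n + 4) k : ℝ) ≤ ‖hat q‖ := not_lt.1 (Nat.find_min hex (by omega))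
    have h3 := hbig k (by omega) q h h1.le
    have h4 := hq.2 (approx n (n + 4) m k)
      (by rw [norm_hat_approx hm hmn]; exact denom_pos _ _) (by rwa [norm_hat_approx hm hmn])
    exact absurd h3 (not_lt.2 h4)
  have hrank : ∀ L : Submodule ℤ (Fin (n + 1) → ℤ),
      (∃ N : ℝ, ∀ q, IsBestApprox x q → N ≤ ‖hat q‖ → q ∈ L) → m + 1 ≤ Module.finrank ℤ L := by
    rintro L ⟨N, hN⟩
    obtain ⟨k₁, hk₁⟩ := exists_nat_ge N
    have hmem : ∀ j : Fin (m + 1), approx n (n + 4) m (max k₀ k₁ + j) ∈ L := by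
      intro j
      have h1 : max k₀ k₁ ≤ max k₀ k₁ + j := Nat.le_add_right _ _
      refine hN _ (hbest _ ((le_max_left _ _).trans h1)) ?_
      rw [norm_hat_approx hm hmn]
      refine hk₁.trans (le_trans ?_ (natCast_le_denom hg _))
      exact_mod_cast (le_max_right _ _).trans h1
    have hli : LinearIndependent ℤ
        fun j : Fin (m + 1) => (⟨approx n (n + 4) m (max k₀ k₁ + j), hmem j⟩ : L) :=
      LinearIndependent.of_comp L.subtype
        (linearIndependent_approx hg hm hmn (max k₀ k₁))
    simpa using hli.fintype_card_le_finrank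
  have hfin : Module.finrank ℤ (coordLattice n m) = m + 1 :=
    le_antisymm (finrank_coordLattice_le hmn) (hrank _ hL)
  refine ⟨hirr, ?_⟩
  rw [hirr.R_eq_finrank (by omega) _ hL (fun L hL' => hfin ▸ hrank L hL'), hfin]

end Lacunary

end BestApprox

theorem mainTheorem8 (n : ℕ) (hn : 2 ≤ n) (r : ℕ) (hr₁ : 3 ≤ r) (hr₂ : r ≤ n + 1) :
    0 < dimH {x : Fin n → ℝ | BestApprox.TotallyIrrational x ∧ BestApprox.R x = r} := by
  -- For `r = n + 1` the lacunary construction would leave no free coordinate, so the generic case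
  -- is used instead.
  rcases hr₂.eq_or_lt with rfl | hlt
  · have : Nonempty {_i : Fin n // True} := ⟨⟨⟨0, by omega⟩, trivial⟩⟩
    exact BestApprox.dimH_pos_of_ae_glue_mem 0 _ (BestApprox.ae_R_eq (by omega))
  · obtain ⟨m, rfl⟩ : ∃ m, r = m + 1 := ⟨r - 1, by omega⟩
    have : Nonempty {i : Fin n // m ≤ i} := ⟨⟨⟨m, by omega⟩, le_rfl⟩⟩
    exact BestApprox.dimH_pos_of_ae_glue_mem _ _
      (BestApprox.ae_glue_lacunary_mem (by omega) (by omega))
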